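/- **Automata.** For a finite alphabet $\Gamma$ and a symbol $\bot\notin\Gamma$, a *$\Gamma$-tree* is a finite binary tree, that is, a map $T$ from a finite, non-empty, prefix-closed set of words over $\{l,r\}$ (the nodes) to $\Gamma\cup\{\bot\}$ with $T(w)=\bot$ if and only if $w$ is the empty word (the root). The *type* of a node tells whether it is the root, a left or a right descendant, whether it has a left descendant, and whether it has a right descendant. A *deterministic tree-walking-storage automaton* has a finite set $Q$ of states, a finite input alphabet $\Sigma$, a finite set $\Gamma$ of tree symbols, an initial state, a set of accepting states, an endmarker $\triangleleft\notin\Sigma$, and a partial transition function $\delta$. From the current state, an element of $\Sigma\cup\{\lambda,\triangleleft\}$ (the next input symbol, or $\lambda$ for reading nothing), and the type and the label of the current tree node, $\delta$ determines a new state and one of the following operations: move the tree pointer to the parent, leave it where it is, move it to the left or to the right descendant, remove the current node if it is a leaf other than the root (the pointer moves to its parent), or append a new left or right descendant, with a label from $\Gamma$, which does not exist yet (the pointer moves to it). It is required that $\delta$ never prescribes an impossible operation, and that wherever $\delta$ is defined for $\lambda$ it is undefined for all symbols of $\Sigma\cup\{\triangleleft\}$ (with the same state, type and label). On input $w\in\Sigma^*$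 the automaton starts in the initial state at the beginning of $w\triangleleft$, with the tree that has only the root. It halts when $\delta$ is undefined for the current configuration, and it accepts $w$ if it halts in an accepting state after having read $w\triangleleft$ entirely. It is *non-erasing* if it never removes a node, and it works in *real time* if $\delta$ is undefined for $\lambda$ (so one input symbol is read in every step). **Proposition.** Let $\mathscr{F}$ be the family of languages (over arbitrary finite alphabets) that are accepted by real-time deterministic tree-walking-storage automata, and let $\mathscr{F}_{\mathrm{ne}}$ be the family of languages that are accepted by non-erasing real-time deterministic tree-walking-storage automata. Neither $\mathscr{F}$ nor $\mathscr{F}_{\mathrm{ne}}$ is closed under concatenation $(L_1,L_2)\mapsto L_1L_2$, and neither of them is closed under iteration (Kleene star) $L\mapsto L^*$. -/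

import Mathlib

/-- The two kinds of descendants, `l` and `r`. -/
inductive Side : Type
  | l
  | r

/-- The address of a node of a binary tree, a word over `{l, r}`.
The list is read from the node up to the root: `[]` is the root, and `d :: P` is the
`d`-descendant of `P` (the address that is written `P d` when words are read from the root). -/
abbrev Address : Type := List Side

/-- A `Γ`-tree: a partial map on addresses with finite, non-empty domain which contains, with a
node, also its ancestors; its values are in `Γ ∪ {⊥}`, and `⊥` is the label of exactly the root.
`label w = none` says that `w` is not a node (the domain is non-empty by `label_eq_bot_iff`). -/
structure GTree (Γ : Type) : Type where
  label : Address → Option (WithBot Γ)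
  finite_dom : {w | (label w).isSome}.Finite
  parent_mem : ∀ (d : Side) (w : Address), (label (d :: w)).isSome → (label w).isSome
  label_eq_bot_iff : ∀ w : Address, label w = some ⊥ ↔ w = []

namespace GTree

variable {Γ : Type}

/-- The tree that consists of the root only. -/
def root : GTree Γ where
  label
    | [] => some ⊥
    | _ :: _ => none
  finite_dom := (Set.finite_singleton ([] : Address)).subset (by
    intro w hw
    cases w with
    | nil => rfl
    | cons d w => simp at hw)
  parent_mem := by intro d w h; simp at h
  label_eq_bot_iff := by intro w; cases w <;> simp

open Classical in
/-- The tree `T` with an additional `d`-descendant of the node `P`, which is labeled by `x`. -/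
noncomputable def push (T : GTree Γ) (P : Address) (hP : (T.label P).isSome) (d : Side) (x : Γ) :
    GTree Γ where
  label := Function.update T.label (d :: P) (some (x : WithBot Γ))
  finite_dom := (T.finite_dom.insert (d :: P)).subset (by
    intro w hw
    by_cases h : w = d :: P
    · exact Or.inl h
    · exact Or.inr (by simpa [Function.update_of_ne h] using hw))
  parent_mem := by
    intro e w hw
    by_cases h' : w = d :: P
    · subst h'; simp
    rw [Function.update_of_ne h']
    by_cases h : e :: w = d :: P
    · obtain ⟨-, rfl⟩ := List.cons.inj h
      exact hP
    · rw [Function.update_of_ne h] at hw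
      exact T.parent_mem e w hw
  label_eq_bot_iff := by
    intro w
    by_cases h : w = d :: P
    · subst h; simp
    · rw [Function.update_of_ne h]; exact T.label_eq_bot_iff w

open Classical in
/-- The tree `T` without the leaf `d :: P`. -/
noncomputable def pop (T : GTree Γ) (d : Side) (P : Address)
    (hleaf : ∀ e : Side, T.label (e :: d :: P) = none) : GTree Γ where
  label := Function.update T.label (d :: P) none
  finite_dom := T.finite_dom.subset (by
    intro w hw
    by_cases h : w = d :: P
    · subst h; simp at hw
    · simpa [Function.update_of_ne h] using hw)
  parent_mem := by
    intro e w hw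
    by_cases h : e :: w = d :: P
    · rw [h] at hw; simp at hw
    rw [Function.update_of_ne h] at hw
    by_cases h' : w = d :: P
    · subst h'; simp [hleaf e] at hw
    · rw [Function.update_of_ne h']
      exact T.parent_mem e w hw
  label_eq_bot_iff := by
    intro w
    by_cases h : w = d :: P
    · subst h; simp
    · rw [Function.update_of_ne h]; exact T.label_eq_bot_iff w

end GTree

/-- The type of a node: whether it is the root (`none`), a left or a right descendant, and whether
it has a left and a right descendant. -/
structure NodeType : Type where
  kind : Option Side
  hasLeft : Bool
  hasRight : Bool

/-- Whether a node of the given type has a `d`-descendant. -/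
def NodeType.hasChild (t : NodeType) : Side → Bool
  | .l => t.hasLeft
  | .r => t.hasRight

/-- The operations on the tree storage: moving the tree pointer up, leaving it where it is, moving
it down to a descendant, removing the current leaf, appending a descendant with label `x`. -/
inductive StorageOp (Γ : Type) : Type
  | up
  | stay
  | down (d : Side)
  | pop
  | push (x : Γ) (d : Side)

/-- The operation is possible at a node of the given type. -/
def StorageOp.Possible {Γ : Type} (t : NodeType) : StorageOp Γ → Prop
  | .up => t.kind ≠ none
  | .stay => True
  | .down d => t.hasChild d = true
  | .pop => t.kind ≠ none ∧ t.hasLeft = false ∧ t.hasRight = false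
  | .push _ d => t.hasChild d = false

/-- A `Γ`-tree together with a tree pointer, which is at one of its nodes. -/
structure Storage (Γ : Type) : Type where
  tree : GTree Γ
  ptr : Address
  ptr_mem : (tree.label ptr).isSome

namespace Storage

variable {Γ : Type}

/-- The initial storage: the tree has only the root, and the tree pointer is there. -/
def init : Storage Γ := ⟨GTree.root, [], rfl⟩

/-- The type of the current node. -/
def nodeType (S : Storage Γ) : NodeType :=
  ⟨S.ptr.head?, (S.tree.label (Side.l :: S.ptr)).isSome, (S.tree.label (Side.r :: S.ptr)).isSome⟩

/-- The label of the current node. -/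
def currentLabel (S : Storage Γ) : WithBot Γ := (S.tree.label S.ptr).get S.ptr_mem

open Classical in
/-- The effect of an operation on the storage (`none` if the operation is not possible). -/
noncomputable def exec : Storage Γ → StorageOp Γ → Option (Storage Γ)
  | ⟨T, d :: P, h⟩, .up => some ⟨T, P, T.parent_mem d P h⟩
  | ⟨_, [], _⟩, .up => none
  | S, .stay => some S
  | ⟨T, P, _⟩, .down d =>
      if h : (T.label (d :: P)).isSome then some ⟨T, d :: P, h⟩ else none
  | ⟨T, d :: P, h⟩, .pop =>
      if hleaf : ∀ e : Side, T.label (e :: d :: P) = none then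
        some ⟨T.pop d P hleaf, P, by
          simpa [GTree.pop, Function.update_of_ne (List.cons_ne_self d P).symm] using
            T.parent_mem d P h⟩
      else none
  | ⟨_, [], _⟩, .pop => none
  | ⟨T, P, h⟩, .push x d =>
      if T.label (d :: P) = none then some ⟨T.push P h d x, d :: P, by simp [GTree.push]⟩ else none

end Storage

/-- The symbols on the input tape: input symbols from `α`, and the endmarker. -/
inductive TapeSymbol (α : Type) : Type
  | sym (a : α)
  | endmarker

/-- A deterministic tree-walking-storage automaton with input symbols `α`, states `Q` and tree
symbols `Γ`. The transition function is partial; its second argument is `none` for a `λ`-step, that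
is, a step that reads nothing, and `some s` for a step that reads the symbol `s`. -/
structure TWSDA (α Q Γ : Type) : Type where
  /-- the transition function -/
  δ : Q → Option (TapeSymbol α) → NodeType → WithBot Γ → Option (Q × StorageOp Γ)
  /-- the initial state -/
  start : Q
  /-- the accepting states -/
  accept : Set Q
  /-- there is never a choice between reading an input symbol and reading nothing -/
  deterministic : ∀ q t x, δ q none t x ≠ none → ∀ s, δ q (some s) t x = none
  /-- no move to a non-existing node, no pop of a non-leaf or of the root, no push of an
  existing descendant -/
  possible : ∀ q s t x q' op, δ q s t x = some (q', op) → op.Possible t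

/-- A configuration: the current state, the unread part of the input, and the storage. -/
structure TWSConfig (α Q Γ : Type) : Type where
  state : Q
  unread : List (TapeSymbol α)
  storage : Storage Γ

namespace TWSDA

variable {α Q Γ : Type}

/-- The initial configuration for the input `w`. -/
def initConfig (M : TWSDA α Q Γ) (w : List α) : TWSConfig α Q Γ :=
  ⟨M.start, w.map TapeSymbol.sym ++ [TapeSymbol.endmarker], Storage.init⟩

/-- One step from a configuration to its successor configuration. -/
def Step (M : TWSDA α Q Γ) (c c' : TWSConfig α Q Γ) : Prop :=
  ∃ (s : Option (TapeSymbol α)) (op : StorageOp Γ),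
    c.unread = s.toList ++ c'.unread ∧
    M.δ c.state s c.storage.nodeType c.storage.currentLabel = some (c'.state, op) ∧
    c.storage.exec op = some c'.storage

/-- The automaton halts: its transition function is not defined for the configuration. -/
def Halts (M : TWSDA α Q Γ) (c : TWSConfig α Q Γ) : Prop :=
  M.δ c.state none c.storage.nodeType c.storage.currentLabel = none ∧
  ∀ s ∈ c.unread.head?, M.δ c.state (some s) c.storage.nodeType c.storage.currentLabel = none

/-- The accepted language: the words on which the automaton halts in an accepting state after
having read the input and the endmarker entirely. -/
def language (M : TWSDA α Q Γ) : Language α :=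
  {w | ∃ c : TWSConfig α Q Γ, Relation.ReflTransGen M.Step (M.initConfig w) c ∧
    c.unread = [] ∧ M.Halts c ∧ c.state ∈ M.accept}

/-- Real time: the transition function is undefined for `λ` input. -/
def RealTime (M : TWSDA α Q Γ) : Prop := ∀ q t x, M.δ q none t x = none

/-- Non-erasing: the automaton never pops from the tree. -/
def NonErasing (M : TWSDA α Q Γ) : Prop :=
  ∀ q s t x q', M.δ q s t x ≠ some (q', StorageOp.pop)

end TWSDA

/-- A family of formal languages over finite alphabets. -/
abbrev LanguageFamily : Type 1 := ∀ (α : Type) [Finite α], Set (Language α)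

/-- The family of languages accepted by real-time deterministic tree-walking-storage automata. -/
def rtTWSDA : LanguageFamily := fun α _ =>
  {L | ∃ (Q Γ : Type) (_ : Finite Q) (_ : Finite Γ) (M : TWSDA α Q Γ),
    M.RealTime ∧ M.language = L}

/-- The family of languages accepted by real-time non-erasing deterministic tree-walking-storage
automata. -/
def rtTWSDNEA : LanguageFamily := fun α _ =>
  {L | ∃ (Q Γ : Type) (_ : Finite Q) (_ : Finite Γ) (M : TWSDA α Q Γ),
    M.RealTime ∧ M.NonErasing ∧ M.language = L}

namespace LanguageFamily

/-- The family contains, with `L₁` and `L₂`, their concatenation. -/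
def ClosedUnderConcatenation (F : LanguageFamily) : Prop :=
  ∀ (α : Type) [Finite α] (L₁ L₂ : Language α), L₁ ∈ F α → L₂ ∈ F α → L₁ * L₂ ∈ F α

/-- The family contains, with `L`, its iteration (Kleene star). -/
def ClosedUnderIteration (F : LanguageFamily) : Prop :=
  ∀ (α : Type) [Finite α] (L : Language α), L ∈ F α → KStar.kstar L ∈ F α

end LanguageFamily

/-! One language `L = optionalRecallLanguage` defeats all four closure properties. Telling where the
remembered block starts is easy for `L`, since it is the first block. In a product or an iteration
of `L`, a hash-free factor may swallow any prefix, so every block before the first hash mark can be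
the one recalled.

Take any `K` with `L * L ≤ K ≤ L∗`. For a list of blocks of length `k`, followed by a hash mark, the
reversal of `x` and a hash mark, membership in `K` says exactly that `x` is one of the blocks
(`recall_mem_mul`, `exists_recall_of_mem_kstar`, `mem_of_blocks_eq`). So the `2 ^ 12 ^ k` sets of
blocks are pairwise distinguished by continuations of `k + 2` tape symbols.

In `k + 2` real-time steps the tree pointer meets only nodes within distance `k + 2`
(`Storage.Agree.accepts`). Up to that distance there are fewer than `2 ^ 12 ^ k` storages for a
suitable `k` (`card_view_lt`), so two sets are confused. On the other hand, `L` itself is accepted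
without erasing by storing the first block on a path and comparing on the way up. -/

/-! ### Runs of real-time automata -/

open Classical in
/-- The state and the storage that a real-time automaton reaches by reading the given symbols. -/
noncomputable def TWSDA.run {α Q Γ : Type} (M : TWSDA α Q Γ) :
    List (TapeSymbol α) → Q → Storage Γ → Option (Q × Storage Γ)
  | [], q, S => some (q, S)
  | s :: w, q, S =>
      (M.δ q (some s) S.nodeType S.currentLabel).bind fun r =>
        (S.exec r.2).bind fun S' => M.run w r.1 S'

/-- Reading the given symbols leads to an accepting state. -/
def TWSDA.Accepts {α Q Γ : Type} (M : TWSDA α Q Γ) (w : List (TapeSymbol α)) (q : Q)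
    (S : Storage Γ) : Prop :=
  ∃ r, M.run w q S = some r ∧ r.1 ∈ M.accept

/-- The symbols on the input tape for the input `w`. -/
def tape {α : Type} (w : List α) : List (TapeSymbol α) :=
  w.map TapeSymbol.sym ++ [TapeSymbol.endmarker]

namespace TWSDA

variable {α Q Γ : Type} {M : TWSDA α Q Γ}

theorem run_append (w₁ w₂ : List (TapeSymbol α)) (q : Q) (S : Storage Γ) :
    M.run (w₁ ++ w₂) q S = (M.run w₁ q S).bind fun r => M.run w₂ r.1 r.2 := by
  induction w₁ generalizing q S with
  | nil => rfl
  | cons s w ih => simp [run, ih, Option.bind_assoc]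

theorem accepts_cons (s : TapeSymbol α) (w : List (TapeSymbol α)) (q : Q) (S : Storage Γ) :
    M.Accepts (s :: w) q S ↔ ∃ q' op S', M.δ q (some s) S.nodeType S.currentLabel = some (q', op) ∧
      S.exec op = some S' ∧ M.Accepts w q' S' := by
  simp only [Accepts, run, Option.bind_eq_some_iff, Prod.exists]
  constructor
  · rintro ⟨a, b, ⟨q', op, h, S', h', h''⟩, ha⟩
    exact ⟨q', op, S', h, h', a, b, h'', ha⟩
  · rintro ⟨q', op, S', h, h', a, b, h'', ha⟩
    exact ⟨a, b, ⟨q', op, h, S', h', h''⟩, ha⟩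

theorem reflTransGen_step_iff_run (hM : M.RealTime) (w : List (TapeSymbol α)) (q : Q)
    (S : Storage Γ) (q' : Q) (S' : Storage Γ) :
    Relation.ReflTransGen M.Step ⟨q, w, S⟩ ⟨q', [], S'⟩ ↔ M.run w q S = some (q', S') := by
  induction w generalizing q S with
  | nil =>
    constructor
    · intro h
      rcases Relation.ReflTransGen.cases_head h with h | ⟨c, ⟨s, op, hs, hδ, -⟩, -⟩
      · simp only [TWSConfig.mk.injEq] at h
        simp [run, h]
      · cases s with
        | none => rw [hM] at hδ; simp at hδ
        | some s => simp at hs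
    · intro h
      simp only [run, Option.some.injEq, Prod.mk.injEq] at h
      rw [h.1, h.2]
  | cons s w ih =>
    constructor
    · intro h
      rcases Relation.ReflTransGen.cases_head h with h | ⟨⟨q₁, w₁, S₁⟩, ⟨s', op, hs, hδ, hop⟩, h⟩
      · simp at h
      · cases s' with
        | none => rw [hM] at hδ; simp at hδ
        | some s' =>
          simp only [Option.toList_some, List.cons_append, List.nil_append, List.cons.injEq] at hs
          obtain ⟨rfl, rfl⟩ := hs
          simp only at hδ hop
          rw [run, hδ, Option.bind_some, hop, Option.bind_some]
          exact (ih _ _).1 h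
    · intro h
      simp only [run, Option.bind_eq_some_iff, Prod.exists] at h
      obtain ⟨q₁, op, hδ, S₁, hop, h⟩ := h
      exact Relation.ReflTransGen.head (b := ⟨q₁, w, S₁⟩) ⟨some s, op, rfl, hδ, hop⟩ ((ih _ _).2 h)

/-- Without `λ`-steps the automaton halts automatically once the endmarker is read, so only the
final state matters. -/
theorem mem_language_iff (hM : M.RealTime) (w : List α) :
    w ∈ M.language ↔ M.Accepts (tape w) M.start Storage.init := by
  constructor
  · rintro ⟨⟨q, u, S⟩, h, hu, -, hq⟩
    simp only at hu
    subst hu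
    exact ⟨_, (reflTransGen_step_iff_run hM _ _ _ _ _).1 h, hq⟩
  · rintro ⟨⟨q, S⟩, h, hq⟩
    exact ⟨⟨q, [], S⟩, (reflTransGen_step_iff_run hM _ _ _ _ _).2 h, rfl, ⟨hM _ _ _, by simp⟩, hq⟩

end TWSDA

/-! ### Locality: bounded computations see a bounded part of the tree -/

/-- The trees of two storages agree up to distance `n` from their tree pointers. -/
def Storage.Agree {Γ : Type} (n : ℕ) (S S' : Storage Γ) : Prop :=
  S.ptr.take n = S'.ptr.take n ∧ ∀ (j : ℕ) (v : Address), j + v.length ≤ n →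
    S.tree.label (v ++ S.ptr.drop j) = S'.tree.label (v ++ S'.ptr.drop j)

namespace Storage

variable {Γ : Type} {n : ℕ} {S S' : Storage Γ}

theorem Agree.nodeType_eq (h : Agree (n + 1) S S') : S.nodeType = S'.nodeType := by
  have h₁ := h.2 0 [Side.l] (by simp)
  have h₂ := h.2 0 [Side.r] (by simp)
  have h₃ := congrArg List.head? h.1
  simp only [List.drop_zero, List.cons_append, List.nil_append] at h₁ h₂
  simp only [List.head?_take, Nat.add_eq_zero_iff, one_ne_zero, and_false, if_false] at h₃
  simp [nodeType, h₁, h₂, h₃]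

theorem Agree.currentLabel_eq (h : Agree n S S') : S.currentLabel = S'.currentLabel := by
  have h₁ := h.2 0 [] (by simp)
  simp only [List.drop_zero, List.nil_append] at h₁
  simp [currentLabel, h₁]

/-- Whether a nearby address is the updated node depends only on the first `j` letters of the
pointer, which agreeing storages share. -/
theorem append_drop_eq_iff {β : Type} (v p : List β) (j : ℕ) :
    v ++ p.drop j = p ↔ v = p.take j := by
  conv_lhs => rhs; rw [← List.take_append_drop j p]
  exact List.append_left_inj _

theorem append_drop_eq_cons_iff {β : Type} (v p : List β) (j : ℕ) (d : β) :
    v ++ p.drop j = d :: p ↔ v = d :: p.take j := by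
  conv_lhs => rhs; rw [← List.take_append_drop j p, ← List.cons_append]
  exact List.append_left_inj _

theorem take_eq_take_of_le {β : Type} {p p' : List β} {m n : ℕ} (h : p.take n = p'.take n)
    (hm : m ≤ n) : p.take m = p'.take m := by
  have := congrArg (List.take m) h
  rwa [List.take_take, List.take_take, min_eq_left hm] at this

theorem Agree.mono {m : ℕ} (h : Agree n S S') (hm : m ≤ n) : Agree m S S' :=
  ⟨take_eq_take_of_le h.1 hm, fun j v hj => h.2 j v (hj.trans hm)⟩

/-- Performing an operation on two storages that agree up to distance `n + 1` is possible for both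
or for none of them, and the results agree up to distance `n`. -/
theorem Agree.exec (h : Agree (n + 1) S S') (op : StorageOp Γ) :
    Option.Rel (Agree n) (S.exec op) (S'.exec op) := by
  classical
  obtain ⟨T, p, hp⟩ := S
  obtain ⟨T', p', hp'⟩ := S'
  obtain ⟨h₁, h₂⟩ := h
  simp only at h₁ h₂
  -- Seen from a child, a path that does not go up is one letter longer from the old pointer; this
  -- uses up the spare unit of distance.
  have down : ∀ (d : Side) (j : ℕ) (v : Address), j + v.length ≤ n →
      T.label (v ++ (d :: p).drop j) = T'.label (v ++ (d :: p').drop j) := by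
    intro d j v hj
    cases j with
    | zero => simpa using h₂ 0 (v ++ [d]) (by simp; omega)
    | succ j => simpa using h₂ j v (by omega)
  have take_cons : ∀ d : Side, (d :: p).take (n + 1) = (d :: p').take (n + 1) := by
    intro d
    simp [take_eq_take_of_le h₁ (Nat.le_succ n)]
  have child : ∀ d : Side, T.label (d :: p) = T'.label (d :: p') := fun d => by
    simpa using h₂ 0 [d] (by simp)
  cases op with
  | up =>
    cases p with
    | nil =>
      cases p' with
      | nil => exact Option.Rel.none
      | cons => simp at h₁
    | cons d p =>
      cases p' with
      | nil => simp at h₁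
      | cons d' p' =>
        simp only [List.take_succ_cons, List.cons.injEq] at h₁
        refine Option.Rel.some ⟨h₁.2, fun j v hj => ?_⟩
        simpa using h₂ (j + 1) v (by omega)
  | stay =>
    cases p <;> cases p' <;> exact Option.Rel.some (Agree.mono ⟨h₁, h₂⟩ (Nat.le_succ n))
  | down d =>
    have hd := child d
    by_cases hT : (T.label (d :: p)).isSome
    · have hT' := hT
      rw [hd] at hT'
      have e : Storage.exec ⟨T, p, hp⟩ (.down d) = some ⟨T, d :: p, hT⟩ := by
        cases p <;> simp [Storage.exec, hT]
      have e' : Storage.exec ⟨T', p', hp'⟩ (.down d) = some ⟨T', d :: p', hT'⟩ := by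
        cases p' <;> simp [Storage.exec, hT']
      rw [e, e']
      exact Option.Rel.some ⟨take_eq_take_of_le (take_cons d) (Nat.le_succ n), down d⟩
    · have hT' := hT
      rw [hd] at hT'
      have e : Storage.exec ⟨T, p, hp⟩ (.down d) = none := by
        cases p <;> simp [Storage.exec, hT]
      have e' : Storage.exec ⟨T', p', hp'⟩ (.down d) = none := by
        cases p' <;> simp [Storage.exec, hT']
      rw [e, e']
      exact Option.Rel.none
  | pop =>
    cases p with
    | nil =>
      cases p' with
      | nil => exact Option.Rel.none
      | cons => simp at h₁
    | cons d p =>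
      cases p' with
      | nil => simp at h₁
      | cons d' p' =>
        simp only [List.take_succ_cons, List.cons.injEq] at h₁
        obtain ⟨rfl, h₁⟩ := h₁
        by_cases hl : ∀ e : Side, T.label (e :: d :: p) = none
        · have hl' : ∀ e : Side, T'.label (e :: d :: p') = none := fun e => child e ▸ hl e
          simp only [Storage.exec, hl, hl', implies_true, dif_pos]
          refine Option.Rel.some ⟨h₁, fun j v hj => ?_⟩
          have e : v ++ p.drop j = d :: p ↔ v ++ p'.drop j = d :: p' := by
            rw [append_drop_eq_cons_iff, append_drop_eq_cons_iff,
              take_eq_take_of_le h₁ (by omega : j ≤ n)]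
          have e' := h₂ (j + 1) v (by omega)
          simp only [List.drop_succ_cons] at e'
          simp only [GTree.pop, Function.update_apply, e, e']
        · have hl' : ¬ ∀ e : Side, T'.label (e :: d :: p') = none :=
            fun hl' => hl fun e => (child e).trans (hl' e)
          simp only [Storage.exec, hl, hl', dif_neg, not_false_eq_true]
          exact Option.Rel.none
  | push x d =>
    have hd := child d
    by_cases hT : T.label (d :: p) = none
    · have hT' := hT
      rw [hd] at hT'
      have e : Storage.exec ⟨T, p, hp⟩ (.push x d) =
          some ⟨T.push p hp d x, d :: p, by simp [GTree.push]⟩ := by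
        cases p <;> simp [Storage.exec, hT]
      have e' : Storage.exec ⟨T', p', hp'⟩ (.push x d) =
          some ⟨T'.push p' hp' d x, d :: p', by simp [GTree.push]⟩ := by
        cases p' <;> simp [Storage.exec, hT']
      rw [e, e']
      refine Option.Rel.some ⟨take_eq_take_of_le (take_cons d) (Nat.le_succ n), fun j v hj => ?_⟩
      have e : v ++ (d :: p).drop j = d :: p ↔ v ++ (d :: p').drop j = d :: p' := by
        rw [append_drop_eq_iff, append_drop_eq_iff,
          take_eq_take_of_le (take_cons d) (by omega : j ≤ n + 1)]
      simp only [GTree.push, Function.update_apply, e, down d j v hj]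
    · have hT' := hT
      rw [hd] at hT'
      have e : Storage.exec ⟨T, p, hp⟩ (.push x d) = none := by
        cases p <;> simp [Storage.exec, hT]
      have e' : Storage.exec ⟨T', p', hp'⟩ (.push x d) = none := by
        cases p' <;> simp [Storage.exec, hT']
      rw [e, e']
      exact Option.Rel.none

/-- Each symbol costs one unit of the radius of agreement, and the next transition depends only on
the pointer's immediate neighbourhood. -/
theorem Agree.accepts {α Q : Type} {M : TWSDA α Q Γ} {w : List (TapeSymbol α)} {q : Q}
    (h : Agree w.length S S') (hS : M.Accepts w q S) : M.Accepts w q S' := by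
  induction w generalizing q S S' with
  | nil =>
    obtain ⟨r, hr, hq⟩ := hS
    simp only [TWSDA.run, Option.some.injEq] at hr
    subst hr
    exact ⟨(q, S'), rfl, hq⟩
  | cons s w ih =>
    rw [TWSDA.accepts_cons] at hS ⊢
    obtain ⟨q', op, S₁, hδ, hop, hS⟩ := hS
    have hex := Agree.exec h op
    rw [hop] at hex
    generalize hy : S'.exec op = y at hex
    cases hex with
    | some h₁ =>
      exact ⟨q', op, _, by rw [← h.nodeType_eq, ← h.currentLabel_eq, hδ], hy, ih h₁ hS⟩

/-! ### Counting the visible parts -/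

/-- The part of the storage up to distance `n` from the tree pointer, as an element of a finite
type. -/
def view (n : ℕ) (S : Storage Γ) : (Fin n → Option Side) ×
    (Fin (n + 1) → (Fin n → Option Side) → Option (WithBot Γ)) :=
  (fun i => S.ptr[(i : ℕ)]?,
    fun j v => S.tree.label ((List.ofFn v).reduceOption ++ S.ptr.drop j))

/-- Words of length at most `n` are coded by functions on `Fin n`, padded with `none`; this decodes
them. -/
theorem reduceOption_ofFn_getElem? {β : Type} (v : List β) (h : v.length ≤ n) :
    (List.ofFn fun i : Fin n => v[(i : ℕ)]?).reduceOption = v := by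
  have : (List.ofFn fun i : Fin n => v[(i : ℕ)]?) =
      v.map some ++ List.replicate (n - v.length) none := by
    apply List.ext_getElem
    · simp; omega
    · intro i hi hi'
      by_cases hv : i < v.length
      · simp [List.getElem_append_left, hv]
      · rw [List.getElem_append_right (by simpa using hv)]
        simpa using hv
  rw [this, List.reduceOption_append, List.reduceOption_replicate_none, List.append_nil]
  simp [List.reduceOption, List.filterMap_map]

theorem agree_of_view_eq (h : S.view n = S'.view n) : Agree n S S' := by
  simp only [view, Prod.mk.injEq] at h
  refine ⟨List.ext_getElem? fun i => ?_, fun j v hj => ?_⟩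
  · rw [List.getElem?_take, List.getElem?_take]
    split_ifs with hi
    · exact congrFun h.1 ⟨i, hi⟩
    · rfl
  · have := congrFun (congrFun h.2 ⟨j, by omega⟩) fun i : Fin n => v[(i : ℕ)]?
    simpa only [reduceOption_ofFn_getElem? v (by omega : v.length ≤ n)] using this

end Storage

/-- The exponent on the left is of order `3 ^ k * (k + 3)`, hence at most a constant times `6 ^ k`.
Twelve letters give `12 ^ k = 6 ^ k * 2 ^ k`, which leaves a factor `2 ^ k` to absorb the constant.
-/
theorem card_view_lt (a b : ℕ) : ∃ k : ℕ,
    a * (3 ^ (k + 2) * ((b ^ 3 ^ (k + 2)) ^ (k + 3))) + 1 < 2 ^ 12 ^ k := by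
  set e := a + b with he
  -- With this choice `6 ^ (k + 2) * (3 + 2 * e) = 6 ^ k * k`, and `k < 2 ^ k`.
  refine ⟨36 * (3 + 2 * e), ?_⟩
  set k := 36 * (3 + 2 * e) with hk
  have ha : a ≤ 2 ^ e := by
    have := (Nat.lt_two_pow_self (n := e)).le
    omega
  have hb : b ≤ 2 ^ e := by
    have := (Nat.lt_two_pow_self (n := e)).le
    omega
  have h3 : 3 ^ (k + 2) ≤ 2 ^ (2 * (k + 2)) := by
    rw [pow_mul]
    exact Nat.pow_le_pow_left (by norm_num) _
  have hv : (b ^ 3 ^ (k + 2)) ^ (k + 3) ≤ 2 ^ (e * (3 ^ (k + 2) * (k + 3))) := by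
    rw [← pow_mul]
    calc _ ≤ (2 ^ e) ^ (3 ^ (k + 2) * (k + 3)) := Nat.pow_le_pow_left hb _
      _ = _ := (pow_mul _ _ _).symm
  have hn : k + 3 ≤ 2 ^ (k + 2) := Nat.lt_two_pow_self
  have h6 : 3 ^ (k + 2) * (k + 3) ≤ 6 ^ (k + 2) := by
    calc _ ≤ 3 ^ (k + 2) * 2 ^ (k + 2) := Nat.mul_le_mul_left _ hn
      _ = 6 ^ (k + 2) := (mul_pow 3 2 (k + 2)).symm
  have h26 : 2 ^ (k + 2) ≤ 6 ^ (k + 2) := Nat.pow_le_pow_left (by norm_num) _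
  have h12 : 12 ^ k = 6 ^ k * 2 ^ k := mul_pow 6 2 k
  have h1 : 1 ≤ 6 ^ (k + 2) := Nat.one_le_pow _ _ (by norm_num)
  have hexp : 1 + (e + (2 * (k + 2) + e * (3 ^ (k + 2) * (k + 3)))) < 12 ^ k := by
    calc _ ≤ 6 ^ (k + 2) * (3 + 2 * e) := by
          have := Nat.mul_le_mul_left e h6
          have := Nat.mul_le_mul_left e h1
          nlinarith
      _ = 6 ^ k * k := by rw [hk, pow_add]; ring
      _ < 6 ^ k * 2 ^ k := by
          exact Nat.mul_lt_mul_of_pos_left Nat.lt_two_pow_self (by positivity)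
      _ = _ := h12.symm
  calc _ ≤ 2 ^ e * (2 ^ (2 * (k + 2)) * 2 ^ (e * (3 ^ (k + 2) * (k + 3)))) + 1 := by gcongr
    _ = 2 ^ (e + (2 * (k + 2) + e * (3 ^ (k + 2) * (k + 3)))) + 1 := by
        rw [pow_add 2 e, pow_add 2 (2 * (k + 2))]
    _ ≤ 2 ^ (1 + (e + (2 * (k + 2) + e * (3 ^ (k + 2) * (k + 3))))) := by
        have := Nat.one_le_two_pow (n := e + (2 * (k + 2) + e * (3 ^ (k + 2) * (k + 3))))
        rw [pow_add 2 1]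
        omega
    _ < _ := Nat.pow_lt_pow_right (by norm_num) hexp

theorem natCard_side : Nat.card Side = 2 := by
  rw [Nat.card_congr (β := Bool) ⟨fun d => match d with | .l => true | .r => false,
    fun b => if b then .l else .r, fun d => by cases d <;> rfl, fun b => by cases b <;> rfl⟩]
  simp

/-- A real-time automaton cannot distinguish all sets of words of a suitable length `k` by
continuations of length `k + 2`. -/
theorem TWSDA.exists_indistinguishable {α Q Γ : Type} [Finite Q] [Finite Γ] (M : TWSDA α Q Γ)
    (q₀ : Q) (S₀ : Storage Γ) :
    ∃ k : ℕ, ∀ P : Set (Fin k → Fin 12) → List (TapeSymbol α), ∃ A B, A ≠ B ∧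
      ∀ w, w.length = k + 2 → (M.Accepts (P A ++ w) q₀ S₀ ↔ M.Accepts (P B ++ w) q₀ S₀) := by
  obtain ⟨k, hk⟩ := card_view_lt (Nat.card Q) (Nat.card (Option (WithBot Γ)))
  refine ⟨k, fun P => ?_⟩
  have : Finite Side := Nat.finite_of_card_ne_zero (by simp [natCard_side])
  have : Finite (WithBot Γ) := inferInstanceAs (Finite (Option Γ))
  -- The outer `Option` covers prefixes on which the run gets stuck; it is the `+ 1` in
  -- `card_view_lt`.
  let f : Set (Fin k → Fin 12) → Option (Q × ((Fin (k + 2) → Option Side) ×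
      (Fin (k + 2 + 1) → (Fin (k + 2) → Option Side) → Option (WithBot Γ)))) :=
    fun A => (M.run (P A) q₀ S₀).map fun r => (r.1, r.2.view (k + 2))
  have hf : ¬ Function.Injective f := fun hf => by
    have h := Nat.card_le_card_of_injective f hf
    have hs : Nat.card (Set (Fin k → Fin 12)) = 2 ^ 12 ^ k := by
      simp [Nat.card_eq_fintype_card]
    rw [hs, Finite.card_option, Nat.card_prod, Nat.card_prod, Nat.card_fun, Nat.card_fun,
      Nat.card_fun, Nat.card_fun, Finite.card_option (α := Side), natCard_side, Nat.card_fin,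
      Nat.card_fin] at h
    exact absurd h (not_le.2 hk)
  simp only [Function.Injective, not_forall] at hf
  obtain ⟨A, B, hAB, hne⟩ := hf
  have key : ∀ A B, f A = f B → ∀ w, w.length = k + 2 →
      M.Accepts (P A ++ w) q₀ S₀ → M.Accepts (P B ++ w) q₀ S₀ := by
    rintro A B hAB w hw ⟨r, hr, hacc⟩
    rw [run_append, Option.bind_eq_some_iff] at hr
    obtain ⟨⟨q, S⟩, hA, hr⟩ := hr
    simp only [f, hA, Option.map_some] at hAB
    obtain ⟨⟨q', S'⟩, hB, he⟩ := Option.map_eq_some_iff.1 hAB.symm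
    simp only [Prod.mk.injEq] at he
    obtain ⟨rfl, he⟩ := he
    obtain ⟨r', hr', hacc'⟩ :=
      (hw ▸ Storage.agree_of_view_eq he.symm : Storage.Agree w.length S S').accepts ⟨r, hr, hacc⟩
    exact ⟨r', by rw [run_append, hB]; exact hr', hacc'⟩
  exact ⟨A, B, hne, fun w hw => ⟨key A B hAB w hw, key B A hAB.symm w hw⟩⟩

/-! ### The witness language, its square and its iteration -/

/-- The alphabet of twelve letters, the separator and the hash mark. -/
abbrev HashAlphabet : Type := Fin 12 ⊕ Bool

/-- The symbol that separates blocks of letters. -/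
abbrev separator : HashAlphabet := Sum.inr false

/-- The symbol that announces the last block, and ends it. -/
abbrev hashMark : HashAlphabet := Sum.inr true

/-- The words `x separator u hashMark xᴿ hashMark` for a block `x` of letters and a word `u`
without hash marks, where `xᴿ` is the reversal of `x`. -/
def recallLanguage : Language HashAlphabet :=
  {w | ∃ (x : List (Fin 12)) (u : List HashAlphabet), hashMark ∉ u ∧
    w = x.map Sum.inl ++ separator :: u ++ hashMark :: (x.reverse.map Sum.inl ++ [hashMark])}

/-- The words without hash marks, and the words of `recallLanguage`. -/
def optionalRecallLanguage : Language HashAlphabet := {w | hashMark ∉ w ∨ w ∈ recallLanguage}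

theorem hashMark_notMem_map_inl (x : List (Fin 12)) : hashMark ∉ x.map Sum.inl := by simp

theorem separator_notMem_map_inl (x : List (Fin 12)) : separator ∉ x.map Sum.inl := by simp

theorem append_cons_inj {β : Type} {c : β} {a a' s s' : List β} (ha : c ∉ a) (ha' : c ∉ a')
    (h : a ++ c :: s = a' ++ c :: s') : a = a' ∧ s = s' := by
  induction a generalizing a' with
  | nil =>
    cases a' with
    | nil => simpa using h
    | cons b a' =>
      simp only [List.nil_append, List.cons_append, List.cons.injEq] at h
      simp [h.1] at ha'
  | cons b a ih =>
    cases a' with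
    | nil =>
      simp only [List.nil_append, List.cons_append, List.cons.injEq] at h
      simp [h.1] at ha
    | cons b' a' =>
      simp only [List.cons_append, List.cons.injEq, List.mem_cons, not_or] at h ha ha' ⊢
      obtain ⟨h₁, h₂⟩ := ih ha.2 ha'.2 h.2
      exact ⟨⟨h.1, h₁⟩, h₂⟩

theorem exists_eq_append_of_notMem {β : Type} {c : β} {a b s t : List β} (ha : c ∉ a)
    (h : a ++ t = b ++ c :: s) : ∃ b', b = a ++ b' ∧ t = b' ++ c :: s := by
  rcases List.append_eq_append_iff.1 h with ⟨b', h₁, h₂⟩ | ⟨b', h₁, h₂⟩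
  · exact ⟨b', h₁, h₂⟩
  · cases b' with
    | nil => exact ⟨[], by simpa using h₁.symm, by simpa using h₂.symm⟩
    | cons d b' =>
      simp only [List.cons_append, List.cons.injEq] at h₂
      simp [h₁, h₂.1] at ha

/-- In a factorization, hash-free factors can only eat into `b`. The first other factor contains
both hash marks, and their positions force its last block to be `y`. -/
theorem exists_recall_of_mem_kstar {b y : List HashAlphabet} (hb : hashMark ∉ b) (hy : hashMark ∉ y)
    (h : b ++ hashMark :: (y ++ [hashMark]) ∈ KStar.kstar optionalRecallLanguage) :
    ∃ (v : List HashAlphabet) (x : List (Fin 12)) (u : List HashAlphabet),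
      b = v ++ x.map Sum.inl ++ separator :: u ∧ y = x.reverse.map Sum.inl := by
  obtain ⟨L, hL, hmem⟩ := Language.mem_kstar.1 h
  clear h
  induction L generalizing b with
  | nil => simp at hL
  | cons w L ih =>
    have hw := hmem w (by simp)
    rw [List.flatten_cons] at hL
    rcases hw with hw | ⟨x, u, hu, rfl⟩
    · obtain ⟨b', rfl, hb'⟩ := exists_eq_append_of_notMem hw hL.symm
      simp only [List.mem_append, not_or] at hb
      obtain ⟨v, x, u, h₁, h₂⟩ := ih hb.2 hb'.symm (fun z hz => hmem z (by simp [hz]))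
      exact ⟨w ++ v, x, u, by simp [h₁], h₂⟩
    · have hx : hashMark ∉ x.map Sum.inl ++ separator :: u := by simp [hu]
      obtain ⟨h₁, h₂⟩ := append_cons_inj hb hx (by simpa using hL)
      have h₂' : y ++ hashMark :: [] = x.reverse.map Sum.inl ++ hashMark :: L.flatten := by
        simpa using h₂
      exact ⟨[], x, u, by simpa using h₁, (append_cons_inj hy (hashMark_notMem_map_inl _) h₂').1⟩

/-- The blocks in the given list, each followed by a separator. -/
def blocks (l : List (List (Fin 12))) : List HashAlphabet :=
  l.flatMap fun x => x.map Sum.inl ++ [separator]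

theorem hashMark_notMem_blocks (l : List (List (Fin 12))) : hashMark ∉ blocks l := by
  simp [blocks]

/-- The common length `k` excludes that `x` is a proper suffix of a block. -/
theorem mem_of_blocks_eq {k : ℕ} {l : List (List (Fin 12))} (hl : ∀ x ∈ l, x.length = k)
    {x : List (Fin 12)} (hx : x.length = k) {v u : List HashAlphabet}
    (h : blocks l = v ++ x.map Sum.inl ++ separator :: u) : x ∈ l := by
  induction l generalizing v with
  | nil => simp [blocks] at h
  | cons z l ih =>
    have h' : z.map Sum.inl ++ separator :: blocks l = v ++ x.map Sum.inl ++ separator :: u := by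
      simpa [blocks] using h
    by_cases hv : separator ∈ v
    · obtain ⟨v₁, v₂, rfl, hv₁⟩ := List.eq_append_cons_of_mem hv
      have h₂ := (append_cons_inj (separator_notMem_map_inl z) hv₁
        (s' := v₂ ++ x.map Sum.inl ++ separator :: u) (h'.trans (by simp))).2
      exact List.mem_cons_of_mem _ (ih (fun x hx => hl x (by simp [hx])) h₂)
    · have h₁ := (append_cons_inj (separator_notMem_map_inl z) (by simp [hv]) h').1
      have hlen := congrArg List.length h₁
      have hz := hl z (by simp)
      have : v = [] := by
        rw [← List.length_eq_zero_iff]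
        simp only [List.length_map, List.length_append] at hlen
        omega
      subst this
      rw [List.nil_append] at h₁
      rw [← List.map_injective_iff.2 Sum.inl_injective h₁]
      simp

/-- The blocks before `x` form a hash-free first factor. -/
theorem recall_mem_mul {l : List (List (Fin 12))} {x : List (Fin 12)} (hx : x ∈ l) :
    blocks l ++ hashMark :: (x.reverse.map Sum.inl ++ [hashMark]) ∈
      optionalRecallLanguage * optionalRecallLanguage := by
  obtain ⟨l₁, l₂, rfl⟩ := List.append_of_mem hx
  refine Language.mem_mul.2 ⟨blocks l₁, Or.inl (hashMark_notMem_blocks _), _,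
    Or.inr ⟨x, blocks l₂, hashMark_notMem_blocks _, rfl⟩, ?_⟩
  simp [blocks]

/-- No language between the square and the iteration of `optionalRecallLanguage` is accepted in
real time. -/
theorem notMem_rtTWSDA_of_mul_le_of_le_kstar {K : Language HashAlphabet}
    (h₁ : optionalRecallLanguage * optionalRecallLanguage ≤ K)
    (h₂ : K ≤ KStar.kstar optionalRecallLanguage) : K ∉ rtTWSDA HashAlphabet := by
  classical
  rintro ⟨Q, Γ, _, _, M, hM, hK⟩
  obtain ⟨k, hk⟩ := M.exists_indistinguishable M.start Storage.init
  let list (A : Set (Fin k → Fin 12)) : List (List (Fin 12)) := A.toFinset.toList.map List.ofFn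
  obtain ⟨A, B, hne, hAB⟩ :=
    hk fun A => (blocks (list A) ++ [hashMark]).map TapeSymbol.sym
  have mem_iff : ∀ (A : Set (Fin k → Fin 12)) (s : Fin k → Fin 12), s ∈ A ↔
      blocks (list A) ++ hashMark :: ((List.ofFn s).reverse.map Sum.inl ++ [hashMark]) ∈ K := by
    intro A s
    constructor
    · intro hs
      exact h₁ (recall_mem_mul (List.mem_map_of_mem (by simpa using hs)))
    · intro hs
      obtain ⟨v, x, u, hb, hy⟩ := exists_recall_of_mem_kstar (hashMark_notMem_blocks _)
        (hashMark_notMem_map_inl _) (h₂ hs)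
      have hx := List.reverse_injective (List.map_injective_iff.2 Sum.inl_injective hy)
      subst hx
      have := mem_of_blocks_eq (k := k) (by simp [list]) (by simp) hb
      obtain ⟨s', hs', he⟩ := List.mem_map.1 this
      rw [List.ofFn_injective he] at hs'
      simpa using hs'
  apply hne
  ext s
  -- The length `k + 2` is made up of `k` letters, the hash mark and the endmarker.
  have h := hAB (tape ((List.ofFn s).reverse.map Sum.inl ++ [hashMark])) (by simp [tape])
  rw [mem_iff, mem_iff, ← hK, TWSDA.mem_language_iff hM, TWSDA.mem_language_iff hM]
  simpa [tape] using h

/-! ### A non-erasing real-time automaton for the witness language -/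

/-- The states of an automaton for `optionalRecallLanguage`. -/
inductive RecallState : Type
  | store
  | skip
  | check
  | done
  | accept

instance : Finite RecallState :=
  Finite.of_surjective (fun i : Fin 5 => match i with
    | 0 => RecallState.store
    | 1 => .skip
    | 2 => .check
    | 3 => .done
    | 4 => .accept) fun q => by
      cases q
      · exact ⟨0, rfl⟩
      · exact ⟨1, rfl⟩
      · exact ⟨2, rfl⟩
      · exact ⟨3, rfl⟩
      · exact ⟨4, rfl⟩

/-- The transitions for `optionalRecallLanguage`: store the first block on a path of left
descendants, skip to the hash mark, and compare the last block with the path on the way up. -/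
def recallδ : RecallState → Option (TapeSymbol HashAlphabet) → NodeType → WithBot (Fin 12) →
    Option (RecallState × StorageOp (Fin 12))
  | .store, some (.sym (.inl a)), t, _ => if t.hasLeft then none else some (.store, .push a .l)
  | .store, some (.sym (.inr false)), _, _ => some (.skip, .stay)
  | .store, some .endmarker, _, _ => some (.accept, .stay)
  | .skip, some (.sym (.inl _)), _, _ => some (.skip, .stay)
  | .skip, some (.sym (.inr false)), _, _ => some (.skip, .stay)
  | .skip, some (.sym (.inr true)), _, _ => some (.check, .stay)
  | .skip, some .endmarker, _, _ => some (.accept, .stay)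
  | .check, some (.sym (.inl a)), t, x =>
      if t.kind.isSome ∧ x = a then some (.check, .up) else none
  | .check, some (.sym (.inr true)), t, _ => if t.kind.isNone then some (.done, .stay) else none
  | .done, some .endmarker, _, _ => some (.accept, .stay)
  | _, _, _, _ => none

/-- An automaton for `optionalRecallLanguage`. -/
def recallAutomaton : TWSDA HashAlphabet RecallState (Fin 12) where
  δ := recallδ
  start := .store
  accept := {.accept}
  deterministic := by
    intro q t x h
    cases q <;> simp [recallδ] at h
  possible := by
    intro q s t x q' op h
    rcases q <;> rcases s with _ | (_ | (_ | _)) | _ <;>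
      simp only [recallδ, reduceCtorEq] at h <;> try split_ifs at h
    all_goals
      simp only [Option.some.injEq, Prod.mk.injEq] at h
      obtain ⟨-, rfl⟩ := h
      simp_all [StorageOp.Possible, NodeType.hasChild, Option.isSome_iff_ne_none]

/-- The nodes of the path of left descendants from the root have, from the end of the path up to
the root, the given labels. -/
def StoresPath (T : GTree (Fin 12)) : List (Fin 12) → Prop
  | [] => True
  | a :: ys => T.label (List.replicate (ys.length + 1) .l) = some (a : WithBot (Fin 12)) ∧
      StoresPath T ys

/-- The new node lies deeper than all nodes of the path. -/
theorem StoresPath.push {T : GTree (Fin 12)} {ys : List (Fin 12)} (h : StoresPath T ys)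
    {P : Address} (hP : (T.label P).isSome) (d : Side) (x : Fin 12) (hlen : ys.length ≤ P.length) :
    StoresPath (T.push P hP d x) ys := by
  induction ys with
  | nil => trivial
  | cons a ys ih =>
    simp only [List.length_cons] at hlen
    refine ⟨?_, ih h.2 (by omega)⟩
    have hne : List.replicate (ys.length + 1) Side.l ≠ d :: P := fun e => by
      have := congrArg List.length e
      simp only [List.length_replicate, List.length_cons] at this
      omega
    classical
    simpa only [GTree.push, Function.update_of_ne hne] using h.1

/-- The tree stores a path of left descendants, and the tree pointer is at its end. -/
def HoldsPath (S : Storage (Fin 12)) (ys : List (Fin 12)) : Prop :=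
  S.ptr = List.replicate ys.length .l ∧ StoresPath S.tree ys

theorem Storage.exec_stay {Γ : Type} (S : Storage Γ) : S.exec .stay = some S := by
  obtain ⟨T, p, h⟩ := S
  cases p <;> rfl

theorem HoldsPath.currentLabel {S : Storage (Fin 12)} {a : Fin 12} {ys : List (Fin 12)}
    (h : HoldsPath S (a :: ys)) : S.currentLabel = a := by
  have h₁ := h.2.1
  rw [← List.length_cons (a := a), ← h.1] at h₁
  simp [Storage.currentLabel, h₁]

theorem HoldsPath.exec_up {S : Storage (Fin 12)} {a : Fin 12} {ys : List (Fin 12)}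
    (h : HoldsPath S (a :: ys)) : ∃ S', S.exec .up = some S' ∧ HoldsPath S' ys := by
  obtain ⟨T, p, hp⟩ := S
  obtain ⟨h₁, h₂⟩ := h
  simp only [List.length_cons, List.replicate_succ] at h₁
  subst h₁
  exact ⟨_, rfl, rfl, h₂.2⟩

theorem HoldsPath.exec_push {S : Storage (Fin 12)} {ys : List (Fin 12)} (h : HoldsPath S ys)
    (hl : S.tree.label (.l :: S.ptr) = none) (a : Fin 12) :
    ∃ S', S.exec (.push a .l) = some S' ∧ HoldsPath S' (a :: ys) ∧
      S'.tree.label (.l :: S'.ptr) = none := by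
  classical
  obtain ⟨T, p, hp⟩ := S
  obtain ⟨h₁, h₂⟩ := h
  simp only at h₁ h₂ hl
  refine ⟨⟨T.push p hp .l a, .l :: p, by simp [GTree.push]⟩, ?_, ⟨?_, ?_, ?_⟩, ?_⟩
  · cases p <;> simp [Storage.exec, hl]
  · simp [h₁, List.replicate_succ]
  · simp [GTree.push, h₁, List.replicate_succ]
  · exact h₂.push hp .l a (by simp [h₁])
  · have hne : Side.l :: Side.l :: p ≠ Side.l :: p := by simp
    simp only [GTree.push, Function.update_of_ne hne]
    -- A left descendant of the new node would already be in `T`, and so would its parent, the new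
    -- node itself.
    by_contra hc
    have := T.parent_mem _ _ (Option.isSome_iff_ne_none.2 hc)
    simp [hl] at this

theorem recallAutomaton_realTime : recallAutomaton.RealTime := by
  intro q t x
  cases q <;> rfl

theorem recallAutomaton_nonErasing : recallAutomaton.NonErasing := by
  intro q s t x q' h
  rcases q <;> rcases s with _ | (_ | (_ | _)) | _ <;> simp [recallAutomaton, recallδ] at h

theorem recallAutomaton_δ : recallAutomaton.δ = recallδ := rfl

theorem accepts_nil (q : RecallState) (S : Storage (Fin 12)) :
    recallAutomaton.Accepts [] q S ↔ q = .accept := by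
  simp [TWSDA.Accepts, TWSDA.run, recallAutomaton]

theorem tape_cons {α : Type} (a : α) (w : List α) : tape (a :: w) = .sym a :: tape w := rfl

theorem tape_nil {α : Type} : tape ([] : List α) = [.endmarker] := rfl

theorem accepts_done (w : List HashAlphabet) (S : Storage (Fin 12)) :
    recallAutomaton.Accepts (tape w) .done S ↔ w = [] := by
  cases w with
  | nil =>
    simp [tape_nil, TWSDA.accepts_cons, accepts_nil, recallAutomaton_δ, recallδ, Storage.exec_stay]
  | cons c w => simp [tape_cons, TWSDA.accepts_cons, recallAutomaton_δ, recallδ]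

/-- Each letter must match a label and moves up, and the hash mark is read only at the root; so the
comparison ends neither early nor late. -/
theorem accepts_check (w : List HashAlphabet) {S : Storage (Fin 12)} {ys : List (Fin 12)}
    (h : HoldsPath S ys) : recallAutomaton.Accepts (tape w) .check S ↔
      w = ys.map Sum.inl ++ [hashMark] := by
  induction w generalizing S ys with
  | nil =>
    simp [tape_nil, TWSDA.accepts_cons, recallAutomaton_δ, recallδ]
  | cons c w ih =>
    have hk : S.nodeType.kind = (List.replicate ys.length Side.l).head? := congrArg List.head? h.1
    rw [tape_cons, TWSDA.accepts_cons]
    rcases c with a | (_ | _)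
    · cases ys with
      | nil => simp [recallAutomaton_δ, recallδ, hk]
      | cons b ys =>
        obtain ⟨S', hS', h'⟩ := h.exec_up
        by_cases hab : b = a
        · subst hab
          simp [recallAutomaton_δ, recallδ, hk, h.currentLabel, List.replicate_succ]
          simpa [hS'] using ih h'
        · have : ¬ a = b := fun e => hab e.symm
          simp [recallAutomaton_δ, recallδ, h.currentLabel, hab, this]
    · cases ys <;> simp [recallAutomaton_δ, recallδ]
    · cases ys with
      | nil =>
        simpa [recallAutomaton_δ, recallδ, hk, Storage.exec_stay] using accepts_done w S
      | cons b ys => simp [recallAutomaton_δ, recallδ, hk, List.replicate_succ]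

theorem accepts_skip (w : List HashAlphabet) {S : Storage (Fin 12)} {ys : List (Fin 12)}
    (h : HoldsPath S ys) : recallAutomaton.Accepts (tape w) .skip S ↔
      hashMark ∉ w ∨ ∃ u, hashMark ∉ u ∧ w = u ++ hashMark :: (ys.map Sum.inl ++ [hashMark]) := by
  induction w with
  | nil =>
    simp [tape_nil, TWSDA.accepts_cons, accepts_nil, recallAutomaton_δ, recallδ, Storage.exec_stay]
  | cons c w ih =>
    rw [tape_cons, TWSDA.accepts_cons]
    have step : c ≠ hashMark →
        (recallAutomaton.Accepts (tape w) .skip S ↔ hashMark ∉ c :: w ∨ ∃ u, hashMark ∉ u ∧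
          c :: w = u ++ hashMark :: (ys.map Sum.inl ++ [hashMark])) := by
      intro hc
      rw [ih, List.mem_cons, or_iff_right (Ne.symm hc)]
      refine or_congr Iff.rfl ⟨?_, ?_⟩
      · rintro ⟨u, hu, rfl⟩
        exact ⟨c :: u, by simpa [Ne.symm hc] using hu, rfl⟩
      · rintro ⟨_ | ⟨d, u⟩, hu, he⟩
        · simp [hc] at he
        · simp only [List.cons_append, List.cons.injEq] at he
          exact ⟨u, fun hm => hu (List.mem_cons_of_mem _ hm), he.2⟩
    rcases c with a | (_ | _)
    · rw [← step (by simp)]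
      simp [recallAutomaton_δ, recallδ, Storage.exec_stay]
    · rw [← step (by simp)]
      simp [recallAutomaton_δ, recallδ, Storage.exec_stay]
    · have : (∃ u, hashMark ∉ u ∧ hashMark :: w =
          u ++ hashMark :: (ys.map Sum.inl ++ [hashMark])) ↔
          w = ys.map Sum.inl ++ [hashMark] := by
        constructor
        · rintro ⟨u, hu, he⟩
          exact (append_cons_inj (a := []) (by simp) hu he).2
        · rintro rfl
          exact ⟨[], by simp, rfl⟩
      rw [this, ← accepts_check w h]
      simp [recallAutomaton_δ, recallδ, Storage.exec_stay]

/-- Generalized over the part `ys` stored so far, latest letter first, so that the induction can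
pass to `a :: ys`. -/
theorem accepts_store (w : List HashAlphabet) {S : Storage (Fin 12)} {ys : List (Fin 12)}
    (h : HoldsPath S ys) (hl : S.tree.label (.l :: S.ptr) = none) :
    recallAutomaton.Accepts (tape w) .store S ↔ hashMark ∉ w ∨
      ∃ (x : List (Fin 12)) (u : List HashAlphabet), hashMark ∉ u ∧ w = x.map Sum.inl ++
        separator :: u ++ hashMark :: ((x.reverse ++ ys).map Sum.inl ++ [hashMark]) := by
  induction w generalizing S ys with
  | nil =>
    simp [tape_nil, TWSDA.accepts_cons, accepts_nil, recallAutomaton_δ, recallδ, Storage.exec_stay]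
  | cons c w ih =>
    rw [tape_cons, TWSDA.accepts_cons]
    rcases c with a | (_ | _)
    · obtain ⟨S', hS', h', hl'⟩ := h.exec_push hl a
      have hleft : S.nodeType.hasLeft = false := by simp [Storage.nodeType, hl]
      trans recallAutomaton.Accepts (tape w) .store S'
      · simp [recallAutomaton_δ, recallδ, hleft, hS']
      rw [ih h' hl', List.mem_cons, or_iff_right (a := hashMark = Sum.inl a) (by simp)]
      refine or_congr Iff.rfl ⟨?_, ?_⟩
      · rintro ⟨x, u, hu, rfl⟩
        exact ⟨a :: x, u, hu, by simp⟩
      · rintro ⟨_ | ⟨b, x⟩, u, hu, he⟩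
        · simp at he
        · simp only [List.map_cons, List.cons_append, List.cons.injEq, Sum.inl.injEq] at he
          obtain ⟨rfl, rfl⟩ := he
          exact ⟨x, u, hu, by simp⟩
    · trans recallAutomaton.Accepts (tape w) .skip S
      · simp [recallAutomaton_δ, recallδ, Storage.exec_stay]
      rw [accepts_skip w h, List.mem_cons, or_iff_right (a := hashMark = separator) (by simp)]
      refine or_congr Iff.rfl ⟨?_, ?_⟩
      · rintro ⟨u, hu, rfl⟩
        exact ⟨[], u, hu, by simp⟩
      · rintro ⟨_ | ⟨b, x⟩, u, hu, he⟩
        · exact ⟨u, hu, by simpa using he⟩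
        · simp at he
    · refine iff_of_false (by simp [recallAutomaton_δ, recallδ]) ?_
      rintro (hc | ⟨_ | ⟨b, x⟩, u, hu, he⟩)
      · simp at hc
      · simp at he
      · simp at he

theorem recallAutomaton_language : recallAutomaton.language = optionalRecallLanguage := by
  ext w
  rw [TWSDA.mem_language_iff recallAutomaton_realTime]
  refine (accepts_store w (S := Storage.init) (ys := []) ⟨rfl, trivial⟩ rfl).trans ?_
  simp only [List.append_nil]
  rfl

/-! ### Conclusion for both families -/

theorem optionalRecallLanguage_mem_rtTWSDNEA : optionalRecallLanguage ∈ rtTWSDNEA HashAlphabet :=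
  ⟨RecallState, Fin 12, inferInstance, inferInstance, recallAutomaton, recallAutomaton_realTime,
    recallAutomaton_nonErasing, recallAutomaton_language⟩

theorem rtTWSDNEA_subset_rtTWSDA (α : Type) [Finite α] : rtTWSDNEA α ⊆ rtTWSDA α := by
  rintro L ⟨Q, Γ, hQ, hΓ, M, hM, -, hL⟩
  exact ⟨Q, Γ, hQ, hΓ, M, hM, hL⟩

theorem mul_self_le_kstar {α : Type} (L : Language α) : L * L ≤ KStar.kstar L := by
  rw [← pow_two]
  exact pow_le_kstar

theorem mainTheorem10 :
    (¬ rtTWSDA.ClosedUnderConcatenation ∧ ¬ rtTWSDA.ClosedUnderIteration) ∧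
    (¬ rtTWSDNEA.ClosedUnderConcatenation ∧ ¬ rtTWSDNEA.ClosedUnderIteration) := by
  -- The two ends of the interval of languages are used. The witness lies in the smaller family and
  -- the results lie outside the larger one, which settles both families.
  have hmul := notMem_rtTWSDA_of_mul_le_of_le_kstar le_rfl (mul_self_le_kstar _)
  have hstar := notMem_rtTWSDA_of_mul_le_of_le_kstar (mul_self_le_kstar _) le_rfl
  have hne := optionalRecallLanguage_mem_rtTWSDNEA
  have hsub := rtTWSDNEA_subset_rtTWSDA HashAlphabet
  exact ⟨⟨fun h => hmul (h _ _ _ (hsub hne) (hsub hne)), fun h => hstar (h _ _ (hsub hne))⟩,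
    fun h => hmul (hsub (h _ _ _ hne hne)), fun h => hstar (hsub (h _ _ hne))⟩
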